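/- All Banach spaces are complex. If $X$ is a closed subspace of a Banach space $Y$, let $$\boldsymbol{\lambda}(X,Y)=\inf\{\|P\| : P\colon Y\to X \text{ bounded linear},\ P|_X=\mathrm{id}_X\}\in[0,\infty],\qquad \inf\emptyset=\infty,$$ and let the projection constant of a Banach space $X$ be $\boldsymbol{\lambda}(X)=\sup \boldsymbol{\lambda}(I(X),Y)$, where the supremum is taken over all Banach spaces $Y$ and all isometric linear embeddings $I\colon X\to Y$ such that $I(X)$ is complemented in $Y$. Let $G$ be a compact abelian group with normalized Haar measure $\mathrm{m}$ and dual group $\widehat G$ (the continuous characters of $G$), and let $E=\{\gamma_1,\dots,\gamma_N\}\subset\widehat G$ be a set of $N\ge 1$ distinct characters. Let $\mathrm{Trig}_E(G)=\mathrm{span}\,E\subset C(G)$, equipped with the supremum norm on $G$. Then there is a least constant $C>0$ such that $$\|P\|_{L_2(G,\mathrm{m})}\le C\,\|P\|_{L_1(G,\mathrm{m})}\qquad\text{for all } P\in \mathrm{Trig}_E(G),$$ and with this constant (the $\Lambda(2)$-constant of $E$) denoted by $C_2$, one has $$C_2^{-1}\sqrt N\ \le\ \boldsymbol{\lambda}\big(\mathrm{Trig}_E(G)\big)\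 \le\ \sqrt N .$$ -/

import Mathlib

open MeasureTheory
open scoped ENNReal

universe u

noncomputable section

/-- The relative projection constant `λ(X, Y) = inf {‖P‖ : P ∈ L(Y, X), P|_X = id_X}` of a
subspace `X` of a complex normed space `Y`, with values in `[0, ∞]` and with `inf ∅ = ∞`. -/
def relProjConst {Y : Type u} [NormedAddCommGroup Y] [NormedSpace ℂ Y]
    (X : Submodule ℂ Y) : ℝ≥0∞ :=
  ⨅ (P : Y →L[ℂ] X) (_ : ∀ x : X, P x = x), ‖P‖ₑ

/-- The (absolute) projection constant `λ(X)` of a complex Banach space `X`: the supremum of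
`λ(I(X), Y)` over all Banach spaces `Y` and all isometric embeddings `I : X → Y` for which `I(X)`
is complemented in `Y`.

The spaces `Y` are taken in the universe of `X`. This loses nothing: the space
of bounded functions on the unit ball of the dual of `X` lives in that universe, contains `X`
isometrically and is isometrically injective, so that the relative projection constant of `X` in
it bounds the one in any other Banach space. -/
def projConst (X : Type u) [NormedAddCommGroup X] [NormedSpace ℂ X] : ℝ≥0∞ :=
  ⨆ (Y : Type u) (_ : NormedAddCommGroup Y) (_ : NormedSpace ℂ Y) (_ : CompleteSpace Y)
    (I : X →ₗᵢ[ℂ] Y) (_ : (LinearMap.range I.toLinearMap).ClosedComplemented),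
    relProjConst (LinearMap.range I.toLinearMap)

section Trig

variable {G : Type u} [CommGroup G] [TopologicalSpace G]

/-- A continuous character `γ : G → 𝕋`, regarded as a continuous complex-valued function. -/
def charFun (γ : PontryaginDual G) : C(G, ℂ) where
  toFun g := (γ g : ℂ)
  continuous_toFun := continuous_subtype_val.comp (map_continuous γ)

/-- `Trig_E(G)`, the span of the set `E` of characters in `C(G)`. For compact `G` it carries the
supremum norm, inherited from `C(G)`. -/
def trigSpace (E : Set (PontryaginDual G)) : Submodule ℂ C(G, ℂ) :=
  Submodule.span ℂ (charFun '' E)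

variable [MeasurableSpace G]

/-- The constants `C > 0` such that `‖P‖_p ≤ C ‖P‖_1` for all `P ∈ Trig_E(G)`, the norms being
those of `L_p(G, m)` and `L_1(G, m)`. -/
def lambdaBounds (m : Measure G) (p : ℝ≥0∞) (E : Set (PontryaginDual G)) : Set ℝ :=
  {C | 0 < C ∧ ∀ P ∈ trigSpace E, eLpNorm P p m ≤ ENNReal.ofReal C * eLpNorm P 1 m}

/-- The `Λ(p)`-constant `C_p(E)` of `E`, the least element of `lambdaBounds m p E`
(a junk value if there is none). -/
def lambdaConst (m : Measure G) (p : ℝ≥0∞) (E : Set (PontryaginDual G)) : ℝ :=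
  sInf (lambdaBounds m p E)

end Trig

end

open scoped ComplexConjugate

/-! Upper bound: Haar measure is replaced by a finite quadrature rule with nodes `x i` and weights
`w i`, exact on all products of a character in `E` with a conjugate of another. Then every `p` in
the span equals `∑ i, w i * p (x i) * K i` with `K i = ∑ γ ∈ E, conj (γ (x i)) γ`. Each evaluation
at `x i` has norm at most one and extends to any superspace by Hahn–Banach, which gives a
projection. Its norm is at most `sup_g ∑ i, w i * ‖K i g‖`, and Cauchy–Schwarz bounds this by `√N`.

Lower bound: let `P` project `C(G)` onto the span and let `D` be the sum of the characters in `E`.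
Averaging `P` over translations turns it into convolution with `D`, so `‖D‖₁ ≤ ‖P‖`. By
orthonormality `√N = ‖D‖₂ ≤ C₂ ‖D‖₁`. -/

/-! ### Finite quadrature from Carathéodory's theorem. -/

theorem IsCompact.isCompact_convexHull_of_finiteDimensional {V : Type*} [NormedAddCommGroup V]
    [NormedSpace ℝ V] [FiniteDimensional ℝ V] {s : Set V} (hs : IsCompact s) :
    IsCompact (convexHull ℝ s) := by
  rcases s.eq_empty_or_nonempty with rfl | ⟨x₀, hx₀⟩
  · simp
  set d := Module.finrank ℝ V + 1
  have hK : IsCompact (stdSimplex ℝ (Fin d) ×ˢ Set.univ.pi fun _ : Fin d => s) :=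
    (isCompact_stdSimplex ℝ (Fin d)).prod (isCompact_univ_pi fun _ => hs)
  have hc : Continuous fun p : (Fin d → ℝ) × (Fin d → V) => ∑ i, p.1 i • p.2 i := by fun_prop
  convert hK.image hc using 1
  apply Set.Subset.antisymm
  · intro x hx
    obtain ⟨ι, _, z, w, hz, hai, hw, hw1, rfl⟩ := eq_pos_convex_span_of_mem_convexHull hx
    have hcard : Fintype.card ι ≤ Fintype.card (Fin d) := by
      rw [Fintype.card_fin]
      exact hai.card_le_finrank_succ.trans
        (Nat.add_le_add_right (Submodule.finrank_le _) 1)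
    obtain ⟨e⟩ := Function.Embedding.nonempty_of_card_le hcard
    classical
    -- Carathéodory gives at most `d` points; the unused slots get weight `0` and the dummy point
    -- `x₀`.
    refine ⟨(Function.extend e w 0, Function.extend e z fun _ => x₀), ⟨⟨?_, ?_⟩, ?_⟩, ?_⟩
    · intro i
      by_cases h : ∃ j, e j = i
      · obtain ⟨j, rfl⟩ := h
        simpa [e.injective.extend_apply] using (hw j).le
      · simp [Function.extend_apply' _ _ _ h]
    · rw [← hw1]
      refine (Fintype.sum_of_injective e e.injective _ _ (fun i hi => ?_) (fun j => ?_)).symm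
      · simp [Function.extend_apply' _ _ _ hi]
      · simp [e.injective.extend_apply]
    · intro i _
      by_cases h : ∃ j, e j = i
      · obtain ⟨j, rfl⟩ := h
        simpa [e.injective.extend_apply] using hz ⟨j, rfl⟩
      · simpa [Function.extend_apply' _ _ _ h] using hx₀
    · refine (Fintype.sum_of_injective e e.injective _ _ (fun i hi => ?_) (fun j => ?_)).symm
      · simp [Function.extend_apply' _ _ _ hi]
      · simp [e.injective.extend_apply]
  · rintro _ ⟨p, ⟨⟨hp0, hp1⟩, hp⟩, rfl⟩
    exact (convex_convexHull ℝ s).sum_mem (fun i _ => hp0 i) hp1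
      fun i hi => subset_convexHull ℝ s (hp i (Set.mem_univ _))

section

variable {G : Type u} [TopologicalSpace G] [CompactSpace G] [MeasurableSpace G] [BorelSpace G]
  (m : Measure G) [IsProbabilityMeasure m]

theorem Continuous.integrable_of_compactSpace' {V : Type*} [NormedAddCommGroup V]
    {f : G → V} (hf : Continuous f) : Integrable f m :=
  hf.integrable_of_hasCompactSupport (HasCompactSupport.of_compactSpace f)

/-- A mean of `F` lies in the closed convex hull of its range. That hull is already closed, so the
mean is a finite convex combination of values. -/
theorem Continuous.exists_finite_quadrature {V : Type*} [NormedAddCommGroup V]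
    [NormedSpace ℝ V] [FiniteDimensional ℝ V] {F : G → V} (hF : Continuous F) :
    ∃ (n : ℕ) (w : Fin n → ℝ) (x : Fin n → G), (∀ i, 0 ≤ w i) ∧ ∑ i, w i = 1 ∧
      ∑ i, w i • F (x i) = ∫ y, F y ∂m := by
  have : CompleteSpace V := FiniteDimensional.complete ℝ V
  have hmem : ∫ y, F y ∂m ∈ convexHull ℝ (Set.range F) :=
    (convex_convexHull ℝ _).integral_mem
      (isCompact_range hF).isCompact_convexHull_of_finiteDimensional.isClosed
      (.of_forall fun y => subset_convexHull ℝ _ ⟨y, rfl⟩) (hF.integrable_of_compactSpace' m)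
  obtain ⟨ι, _, w, z, hw, hw1, hz, h⟩ := mem_convexHull_iff_exists_fintype.1 hmem
  choose x hx using hz
  let e := Fintype.equivFin ι
  refine ⟨_, w ∘ e.symm, x ∘ e.symm, fun i => hw _, ?_, ?_⟩
  · rw [← hw1]; exact e.symm.sum_comp w
  · rw [← h]
    simp only [Function.comp, hx]
    exact e.symm.sum_comp fun i => w i • z i

end

/-! ### Orthogonality of characters and the Λ(2)-constant. -/

section Characters

variable {G : Type u} [CommGroup G] [TopologicalSpace G]

theorem charFun_mul (γ : PontryaginDual G) (g h : G) :
    charFun γ (g * h) = charFun γ g * charFun γ h := by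
  simp [_root_.charFun]

theorem norm_charFun_apply (γ : PontryaginDual G) (g : G) : ‖charFun γ g‖ = 1 :=
  Circle.norm_coe (γ g)

theorem charFun_mul_conj (γ : PontryaginDual G) (g : G) :
    charFun γ g * conj (charFun γ g) = 1 := by
  rw [Complex.mul_conj, Complex.normSq_eq_norm_sq, norm_charFun_apply]; simp

theorem charFun_mem_trigSpace {E : Set (PontryaginDual G)} {γ : PontryaginDual G} (h : γ ∈ E) :
    charFun γ ∈ trigSpace E :=
  Submodule.subset_span ⟨γ, h, rfl⟩

instance finiteDimensional_trigSpace (E : Finset (PontryaginDual G)) :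
    FiniteDimensional ℂ (trigSpace (E : Set (PontryaginDual G))) :=
  FiniteDimensional.span_of_finite ℂ (E.finite_toSet.image _)

/-- The sum of the characters in `E`, the convolution kernel of the projection onto
`trigSpace E`. -/
noncomputable def dirichletKernel (E : Finset (PontryaginDual G)) : C(G, ℂ) :=
  ∑ γ ∈ E, charFun γ

theorem dirichletKernel_apply (E : Finset (PontryaginDual G)) (g : G) :
    dirichletKernel E g = ∑ γ ∈ E, charFun γ g := by
  simp [dirichletKernel, ContinuousMap.sum_apply]

theorem dirichletKernel_mem (E : Finset (PontryaginDual G)) :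
    dirichletKernel E ∈ trigSpace (E : Set (PontryaginDual G)) :=
  Submodule.sum_mem _ fun _ hγ => charFun_mem_trigSpace hγ

variable [MeasurableSpace G] (m : Measure G) [IsProbabilityMeasure m]

theorem eLpNorm_charFun (γ : PontryaginDual G) (p : ℝ≥0∞) (hp : p ≠ 0) :
    eLpNorm (charFun γ) p m = 1 := by
  rw [← eLpNorm_norm]
  simp only [norm_charFun_apply]
  rw [eLpNorm_const _ hp (IsProbabilityMeasure.ne_zero m)]
  simp

/-- Tested on a single character; this keeps the infimum of the bounds positive. -/
theorem one_le_of_mem_lambdaBounds {E : Finset (PontryaginDual G)} (hE : E.Nonempty) {C : ℝ}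
    (hC : C ∈ lambdaBounds m 2 (E : Set (PontryaginDual G))) : 1 ≤ C := by
  obtain ⟨γ, hγ⟩ := hE
  have := hC.2 _ (charFun_mem_trigSpace hγ)
  rw [eLpNorm_charFun m γ 2 two_ne_zero, eLpNorm_charFun m γ 1 one_ne_zero, mul_one] at this
  simpa using this

variable [BorelSpace G]

open scoped Classical in
theorem integral_charFun_mul_conj [IsTopologicalGroup G] [m.IsHaarMeasure]
    (γ γ' : PontryaginDual G) :
    ∫ g, charFun γ g * conj (charFun γ' g) ∂m = if γ = γ' then 1 else 0 := by
  split_ifs with h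
  · subst h
    simp [charFun_mul_conj]
  · obtain ⟨h₀, hh⟩ : ∃ h₀, γ h₀ ≠ γ' h₀ := by
      by_contra! hc
      exact h (PontryaginDual.ext hc)
    -- Translation by `h₀` multiplies the integral by a factor different from `1`, so it vanishes.
    have key := integral_mul_left_eq_self (μ := m)
      (fun g => charFun γ g * conj (charFun γ' g)) h₀
    have h2 : ∀ g, charFun γ (h₀ * g) * conj (charFun γ' (h₀ * g)) =
        (charFun γ h₀ * conj (charFun γ' h₀)) * (charFun γ g * conj (charFun γ' g)) := by
      intro g
      rw [charFun_mul, charFun_mul, map_mul]; ring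
    simp only [h2] at key
    rw [integral_const_mul] at key
    by_contra hne
    have h1 : charFun γ h₀ * conj (charFun γ' h₀) = 1 := by
      simpa [hne] using key
    apply hh
    apply Subtype.ext
    change charFun γ h₀ = charFun γ' h₀
    calc charFun γ h₀ = charFun γ h₀ * conj (charFun γ' h₀) * charFun γ' h₀ := by
          rw [mul_assoc, mul_comm (conj _), charFun_mul_conj, mul_one]
      _ = _ := by rw [h1, one_mul]

variable [CompactSpace G]

/-- The Fourier coefficient `f ↦ ∫ f γ̄ dm` as a functional on `C(G)`. -/
noncomputable def fourierFunctional (γ : PontryaginDual G) : C(G, ℂ) →L[ℂ] ℂ :=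
  LinearMap.mkContinuous
    { toFun := fun f => ∫ g, f g * conj (charFun γ g) ∂m
      map_add' := fun f f' => by
        simp only [ContinuousMap.add_apply, add_mul]
        exact integral_add (Continuous.integrable_of_compactSpace' m (by fun_prop))
          (Continuous.integrable_of_compactSpace' m (by fun_prop))
      map_smul' := fun c f => by
        simp only [ContinuousMap.smul_apply, smul_eq_mul, mul_assoc, RingHom.id_apply]
        exact integral_const_mul _ _ } 1
    fun f => by
      refine (norm_integral_le_of_norm_le_const (C := ‖f‖) (.of_forall fun g => ?_)).trans ?_
      · simpa [norm_charFun_apply] using f.norm_coe_le_norm g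
      · simp

theorem fourierFunctional_apply (γ : PontryaginDual G) (f : C(G, ℂ)) :
    fourierFunctional m γ f = ∫ g, f g * conj (charFun γ g) ∂m := rfl

theorem enorm_fourierFunctional_le (γ : PontryaginDual G) (f : C(G, ℂ)) :
    ‖fourierFunctional m γ f‖ₑ ≤ eLpNorm f 1 m := by
  rw [fourierFunctional_apply, eLpNorm_one_eq_lintegral_enorm]
  refine (enorm_integral_le_lintegral_enorm _).trans (lintegral_mono fun g => ?_)
  rw [enorm_mul, RCLike.enorm_conj, ← ofReal_norm (charFun γ g), norm_charFun_apply]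
  simp

variable [IsTopologicalGroup G] [m.IsHaarMeasure]

open scoped Classical in
theorem fourierFunctional_charFun (γ γ' : PontryaginDual G) :
    fourierFunctional m γ' (charFun γ) = if γ = γ' then 1 else 0 :=
  integral_charFun_mul_conj m γ γ'

theorem sum_fourierFunctional_smul {E : Finset (PontryaginDual G)} {p : C(G, ℂ)}
    (hp : p ∈ trigSpace (E : Set (PontryaginDual G))) :
    ∑ γ ∈ E, fourierFunctional m γ p • charFun γ = p := by
  classical
  induction hp using Submodule.span_induction with
  | mem x hx =>
    obtain ⟨γ, hγ, rfl⟩ := hx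
    have hγ' : γ ∈ E := hγ
    simp [fourierFunctional_charFun, hγ']
  | zero => simp
  | add x y _ _ hx hy => simp [add_smul, Finset.sum_add_distrib, hx, hy]
  | smul c x _ hx => simp [mul_smul, ← Finset.smul_sum, hx]

theorem integral_norm_dirichletKernel_sq (E : Finset (PontryaginDual G)) :
    ∫ g, ‖dirichletKernel E g‖ ^ 2 ∂m = E.card := by
  classical
  have h : ∫ g, dirichletKernel E g * conj (dirichletKernel E g) ∂m = E.card := by
    simp only [dirichletKernel_apply, map_sum, Finset.sum_mul_sum]
    rw [integral_finsetSum _ fun γ _ => Continuous.integrable_of_compactSpace' m (by fun_prop)]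
    have hint : ∀ γ ∈ E, ∫ g, ∑ γ' ∈ E, charFun γ g * conj (charFun γ' g) ∂m = 1 := by
      intro γ hγ
      rw [integral_finsetSum _ fun γ' _ => Continuous.integrable_of_compactSpace' m (by fun_prop)]
      simp [integral_charFun_mul_conj, hγ]
    rw [Finset.sum_congr rfl hint]
    simp
  simp_rw [Complex.mul_conj, Complex.normSq_eq_norm_sq] at h
  rw [integral_complex_ofReal] at h
  exact_mod_cast h

/-- A crude bound, from Fourier coefficients being at most the `L₁` norm; it only serves to show
that some bound exists. -/
theorem card_mem_lambdaBounds {E : Finset (PontryaginDual G)} (hE : E.Nonempty) :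
    (E.card : ℝ) ∈ lambdaBounds m 2 (E : Set (PontryaginDual G)) := by
  refine ⟨by exact_mod_cast hE.card_pos, fun p hp => ?_⟩
  calc eLpNorm p 2 m
      = eLpNorm (∑ γ ∈ E, fourierFunctional m γ p • (charFun γ : G → ℂ)) 2 m := by
        conv_lhs => rw [← sum_fourierFunctional_smul m hp]
        congr 1
        ext g
        simp [ContinuousMap.sum_apply]
    _ ≤ ∑ γ ∈ E, eLpNorm (fourierFunctional m γ p • (charFun γ : G → ℂ)) 2 m :=
        eLpNorm_sum_le (fun γ _ => ((charFun γ).continuous.integrable_of_compactSpace'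
          m).aestronglyMeasurable.const_smul _) (by norm_num)
    _ ≤ ∑ γ ∈ E, eLpNorm p 1 m := by
        refine Finset.sum_le_sum fun γ _ => ?_
        rw [eLpNorm_const_smul, eLpNorm_charFun m γ 2 two_ne_zero, mul_one]
        exact enorm_fourierFunctional_le m γ p
    _ = _ := by simp

theorem isLeast_lambdaConst {E : Finset (PontryaginDual G)} (hE : E.Nonempty) :
    IsLeast (lambdaBounds m 2 (E : Set (PontryaginDual G)))
      (lambdaConst m 2 (E : Set (PontryaginDual G))) := by
  have hbdd : BddBelow (lambdaBounds m 2 (E : Set (PontryaginDual G))) :=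
    ⟨0, fun C hC => hC.1.le⟩
  have hne : (lambdaBounds m 2 (E : Set (PontryaginDual G))).Nonempty :=
    ⟨_, card_mem_lambdaBounds m hE⟩
  refine ⟨⟨zero_lt_one.trans_le (le_csInf hne fun C hC => one_le_of_mem_lambdaBounds m hE hC),
    fun p hp => ?_⟩, fun C hC => csInf_le hbdd hC⟩
  have hfin : eLpNorm p 1 m ≠ ∞ :=
    (memLp_one_iff_integrable.2 (p.continuous.integrable_of_compactSpace' m)).eLpNorm_ne_top
  -- For fixed `p` the inequality is a closed condition on `C`, because `‖p‖₁` is finite. Hence it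
  -- passes to the infimum.
  have hcl : IsClosed {C : ℝ | eLpNorm p 2 m ≤ ENNReal.ofReal C * eLpNorm p 1 m} := by
    refine isClosed_le continuous_const ?_
    exact (ENNReal.continuous_mul_const hfin).comp ENNReal.continuous_ofReal
  have hsub : closure (lambdaBounds m 2 (E : Set (PontryaginDual G))) ⊆
      {C : ℝ | eLpNorm p 2 m ≤ ENNReal.ofReal C * eLpNorm p 1 m} :=
    closure_minimal (fun C hC => hC.2 p hp) hcl
  exact hsub (csInf_mem_closure hne hbdd)

end Characters

/-! ### Upper bound: extending a discretized orthogonal projection. -/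

section UpperBound

variable {G : Type u} [CommGroup G] [TopologicalSpace G]

/-- Discrete orthonormality and `|γ g| = 1` give the kernel squared `L₂(w)` norm `N`; Cauchy–Schwarz
against total mass one does the rest. -/
theorem sum_quadrature_norm_le {E : Finset (PontryaginDual G)} {n : ℕ} {w : Fin n → ℝ}
    {x : Fin n → G} [DecidableEq (PontryaginDual G)] (hw : ∀ i, 0 ≤ w i) (hw1 : ∑ i, w i = 1)
    (hq : ∀ γ ∈ E, ∀ γ' ∈ E, ∑ i, (w i : ℂ) * (charFun γ (x i) * conj (charFun γ' (x i))) =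
        if γ = γ' then 1 else 0) (g : G) :
    ∑ i, w i * ‖∑ γ ∈ E, conj (charFun γ (x i)) * charFun γ g‖ ≤ √(E.card : ℝ) := by
  set K : Fin n → ℂ := fun i => ∑ γ ∈ E, conj (charFun γ (x i)) * charFun γ g
  have hK : ∑ i, w i * ‖K i‖ ^ 2 = E.card := by
    have : ∑ i, (w i : ℂ) * (K i * conj (K i)) = E.card := by
      calc ∑ i, (w i : ℂ) * (K i * conj (K i))
          = ∑ i, ∑ γ ∈ E, ∑ γ' ∈ E, (charFun γ g * conj (charFun γ' g)) *
              ((w i : ℂ) * (charFun γ' (x i) * conj (charFun γ (x i)))) := by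
            refine Finset.sum_congr rfl fun i _ => ?_
            simp only [K, map_sum, map_mul, Complex.conj_conj]
            rw [Finset.sum_mul_sum]
            simp only [Finset.mul_sum]
            refine Finset.sum_congr rfl fun γ _ => Finset.sum_congr rfl fun γ' _ => ?_
            ring
        _ = ∑ γ ∈ E, ∑ γ' ∈ E, (charFun γ g * conj (charFun γ' g)) *
              ∑ i, ((w i : ℂ) * (charFun γ' (x i) * conj (charFun γ (x i)))) := by
            rw [Finset.sum_comm]
            refine Finset.sum_congr rfl fun γ _ => ?_
            rw [Finset.sum_comm]
            simp only [Finset.mul_sum]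
        _ = ∑ γ ∈ E, (1 : ℂ) := by
            refine Finset.sum_congr rfl fun γ hγ => ?_
            rw [Finset.sum_congr rfl fun γ' h' => by rw [hq γ' h' γ hγ]]
            simp [hγ, charFun_mul_conj]
        _ = E.card := by simp
    simp_rw [Complex.mul_conj, Complex.normSq_eq_norm_sq] at this
    exact_mod_cast this
  refine Real.le_sqrt_of_sq_le ?_
  have := Finset.sum_sq_le_sum_mul_sum_of_sq_le_mul Finset.univ (r := fun i => w i * ‖K i‖)
    (f := w) (g := fun i => w i * ‖K i‖ ^ 2) (fun i _ => hw i)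
    (fun i _ => mul_nonneg (hw i) (sq_nonneg _)) (fun i _ => le_of_eq (by ring))
  rwa [hw1, hK, one_mul] at this

variable [CompactSpace G]

theorem sum_quadrature_smul {E : Finset (PontryaginDual G)} {n : ℕ} {w : Fin n → ℝ}
    {x : Fin n → G} [DecidableEq (PontryaginDual G)]
    (hq : ∀ γ ∈ E, ∀ γ' ∈ E, ∑ i, (w i : ℂ) * (charFun γ (x i) * conj (charFun γ' (x i))) =
        if γ = γ' then 1 else 0) {p : C(G, ℂ)}
    (hp : p ∈ trigSpace (E : Set (PontryaginDual G))) :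
    ∑ γ ∈ E, (∑ i, (w i : ℂ) * (p (x i) * conj (charFun γ (x i)))) • charFun γ = p := by
  induction hp using Submodule.span_induction with
  | mem p hp =>
    obtain ⟨γ, hγ, rfl⟩ := hp
    have hγ' : γ ∈ E := hγ
    rw [Finset.sum_congr rfl fun γ' h' => by rw [hq γ hγ' γ' h']]
    simp [hγ']
  | zero => simp
  | add p q _ _ hp hq =>
    simp [add_smul, add_mul, mul_add, Finset.sum_add_distrib, hp, hq]
  | smul c p _ hp =>
    conv_rhs => rw [← hp]
    rw [Finset.smul_sum]
    refine Finset.sum_congr rfl fun γ _ => ?_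
    rw [smul_smul, Finset.mul_sum]
    congr 1
    refine Finset.sum_congr rfl fun i _ => ?_
    simp only [ContinuousMap.smul_apply, smul_eq_mul]; ring

variable [IsTopologicalGroup G] [MeasurableSpace G] [BorelSpace G]

open scoped Classical in
theorem exists_orthonormal_quadrature (m : Measure G) [m.IsHaarMeasure] [IsProbabilityMeasure m]
    (E : Finset (PontryaginDual G)) :
    ∃ (n : ℕ) (w : Fin n → ℝ) (x : Fin n → G), (∀ i, 0 ≤ w i) ∧ ∑ i, w i = 1 ∧
      ∀ γ ∈ E, ∀ γ' ∈ E, ∑ i, (w i : ℂ) * (charFun γ (x i) * conj (charFun γ' (x i))) =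
        if γ = γ' then 1 else 0 := by
  -- All products are bundled into one vector-valued function, so that the same nodes serve every
  -- pair.
  let F : G → (E × E → ℂ) := fun g q => charFun q.1.1 g * conj (charFun q.2.1 g)
  have hF : Continuous F := by unfold F; fun_prop
  obtain ⟨n, w, x, hw, hw1, h⟩ := hF.exists_finite_quadrature m
  refine ⟨n, w, x, hw, hw1, fun γ hγ γ' hγ' => ?_⟩
  have h2 := congrFun h (⟨γ, hγ⟩, ⟨γ', hγ'⟩)
  rw [eval_integral fun q => Continuous.integrable_of_compactSpace' m (by fun_prop)] at h2
  rw [← integral_charFun_mul_conj m γ γ', ← h2]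
  simp [F, Finset.sum_apply]

theorem relProjConst_range_le (m : Measure G) [m.IsHaarMeasure] [IsProbabilityMeasure m]
    (E : Finset (PontryaginDual G)) {Y : Type u}
    [NormedAddCommGroup Y] [NormedSpace ℂ Y]
    (I : trigSpace (E : Set (PontryaginDual G)) →ₗᵢ[ℂ] Y) :
    relProjConst (LinearMap.range I.toLinearMap) ≤ ENNReal.ofReal √(E.card : ℝ) := by
  classical
  obtain ⟨n, w, x, hw, hw1, hq⟩ := exists_orthonormal_quadrature m E
  let ψ : Fin n → StrongDual ℂ (LinearMap.range I.toLinearMap) := fun i =>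
    (ContinuousMap.evalCLM ℂ (x i) ∘L
      (trigSpace (E : Set (PontryaginDual G))).subtypeL) ∘L
        (I.equivRange.symm.toContinuousLinearEquiv : _ →L[ℂ] _)
  have hψ : ∀ i, ‖ψ i‖ ≤ 1 := fun i => by
    refine ContinuousLinearMap.opNorm_le_bound _ zero_le_one fun p => ?_
    rw [one_mul, ← I.equivRange.symm.norm_map p]
    exact ContinuousMap.norm_coe_le_norm _ (x i)
  -- With finitely many nodes the Hahn–Banach extensions can be chosen independently; no
  -- measurability in the node is needed.
  choose φ hφ hφn using fun i => exists_extension_norm_eq (LinearMap.range I.toLinearMap) (ψ i)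
  let T : Y →L[ℂ] trigSpace (E : Set (PontryaginDual G)) :=
    ∑ γ : E, (∑ i, ((w i : ℂ) * conj (charFun γ.1 (x i))) • φ i).smulRight
      ⟨charFun γ.1, charFun_mem_trigSpace γ.2⟩
  have hT : ∀ y, (T y : C(G, ℂ)) =
      ∑ γ ∈ E, (∑ i, (w i : ℂ) * (φ i y * conj (charFun γ (x i)))) • charFun γ := by
    intro y
    rw [← Finset.sum_coe_sort E]
    simp only [T, sum_apply, Submodule.coe_sum,
      ContinuousLinearMap.smulRight_apply, Submodule.coe_smul, smul_apply,
      smul_eq_mul]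
    simp only [mul_assoc, mul_comm (φ _ y)]
  have hTn : ∀ y, ‖T y‖ ≤ √(E.card : ℝ) * ‖y‖ := by
    intro y
    refine (ContinuousMap.norm_le _ (by positivity)).2 fun g => ?_
    have e : (T y : C(G, ℂ)) g =
        ∑ i, φ i y * ((w i : ℂ) * ∑ γ ∈ E, conj (charFun γ (x i)) * charFun γ g) := by
      rw [hT, ContinuousMap.sum_apply]
      simp only [ContinuousMap.smul_apply, smul_eq_mul, Finset.sum_mul, Finset.mul_sum]
      rw [Finset.sum_comm]
      refine Finset.sum_congr rfl fun i _ => Finset.sum_congr rfl fun γ _ => ?_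
      ring
    change ‖(T y : C(G, ℂ)) g‖ ≤ _
    rw [e, mul_comm]
    calc _ ≤ ∑ i, ‖y‖ * (w i * ‖∑ γ ∈ E, conj (charFun γ (x i)) * charFun γ g‖) := by
          refine norm_sum_le_of_le _ fun i _ => ?_
          rw [norm_mul, norm_mul, Complex.norm_real, Real.norm_of_nonneg (hw i)]
          gcongr
          · exact mul_nonneg (hw i) (norm_nonneg _)
          · refine ((φ i).le_opNorm y).trans ?_
            rw [hφn]
            exact mul_le_of_le_one_left (norm_nonneg _) (hψ i)
      _ ≤ _ := by
          rw [← Finset.mul_sum]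
          gcongr
          exact sum_quadrature_norm_le hw hw1 hq g
  let P : Y →L[ℂ] LinearMap.range I.toLinearMap :=
    (I.equivRange.toContinuousLinearEquiv : _ →L[ℂ] _) ∘L T
  have hP : ∀ p : LinearMap.range I.toLinearMap, P p = p := by
    intro p
    obtain ⟨q, rfl⟩ := I.equivRange.surjective p
    change I.equivRange (T _) = I.equivRange q
    congr 1
    apply Subtype.ext
    rw [hT]
    refine Eq.trans ?_ (sum_quadrature_smul hq q.2)
    refine Finset.sum_congr rfl fun γ _ => ?_
    congr 1
    refine Finset.sum_congr rfl fun i _ => ?_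
    rw [hφ]
    congr 2
    change (I.equivRange.symm (I.equivRange q) : C(G, ℂ)) (x i) = _
    rw [I.equivRange.symm_apply_apply]
  refine (iInf₂_le P hP).trans ?_
  rw [← ofReal_norm]
  refine ENNReal.ofReal_le_ofReal (ContinuousLinearMap.opNorm_le_bound _ (by positivity) fun y => ?_)
  change ‖I.equivRange (T y)‖ ≤ _
  rw [I.equivRange.norm_map]
  exact hTn y

theorem projConst_trigSpace_le (m : Measure G) [m.IsHaarMeasure] [IsProbabilityMeasure m]
    (E : Finset (PontryaginDual G)) :
    projConst (trigSpace (E : Set (PontryaginDual G))) ≤ ENNReal.ofReal √(E.card : ℝ) := by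
  refine iSup_le fun Y => iSup_le fun _ => iSup_le fun _ => iSup_le fun _ => iSup_le fun I =>
    iSup_le fun _ => ?_
  exact relProjConst_range_le m E I

end UpperBound

/-! ### Lower bound: averaging a projection over translations. -/

section LowerBound

variable {G : Type u} [CommGroup G] [TopologicalSpace G] [IsTopologicalGroup G]

/-- The left leftTranslate `h ↦ f (g * h)`, jointly continuous in `g` and `h`. -/
noncomputable def leftTranslate (f : C(G, ℂ)) : C(G, C(G, ℂ)) :=
  ContinuousMap.curry ⟨fun q : G × G => f (q.1 * q.2), by fun_prop⟩

theorem leftTranslate_apply (f : C(G, ℂ)) (g h : G) : leftTranslate f g h = f (g * h) := rfl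

variable [CompactSpace G]

theorem norm_leftTranslate_le (f : C(G, ℂ)) (g : G) : ‖leftTranslate f g‖ ≤ ‖f‖ :=
  (ContinuousMap.norm_le _ (norm_nonneg f)).2 fun h => f.norm_coe_le_norm (g * h)

variable [MeasurableSpace G] [BorelSpace G]
  (m : Measure G) [m.IsHaarMeasure] [IsProbabilityMeasure m]

theorem integral_conj_charFun_smul_leftTranslate (γ : PontryaginDual G) (f : C(G, ℂ)) :
    ∫ g, conj (charFun γ g) • leftTranslate f g ∂m = fourierFunctional m γ f • charFun γ := by
  ext h
  have hint : Integrable (fun g => conj (charFun γ g) • leftTranslate f g) m :=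
    Continuous.integrable_of_compactSpace' m (by fun_prop)
  change ContinuousMap.evalCLM ℂ h (∫ g, conj (charFun γ g) • leftTranslate f g ∂m) = _
  rw [← ContinuousLinearMap.integral_comp_comm _ hint]
  simp only [ContinuousMap.evalCLM_apply, ContinuousMap.smul_apply, smul_eq_mul, leftTranslate_apply]
  rw [fourierFunctional_apply, ← integral_mul_const,
    ← integral_mul_right_eq_self (μ := m) (fun g => f g * conj (charFun γ g) * charFun γ h) h]
  congr 1
  ext g
  rw [charFun_mul, map_mul (starRingEnd ℂ)]
  linear_combination (-(conj (charFun γ g) * f (g * h))) * charFun_mul_conj γ h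

/-- The integral is the mean over `g` of `P (leftTranslate f g) g⁻¹`, whose values are at most `‖P‖
* ‖f‖`. To identify the two, `P` is moved outside the vector-valued integral of translates against
`conj γ`, which is a multiple of `γ` and so fixed by `P`. -/
theorem norm_integral_mul_conj_dirichletKernel_le {E : Finset (PontryaginDual G)}
    {P : C(G, ℂ) →L[ℂ] C(G, ℂ)}
    (hPmem : ∀ f, P f ∈ trigSpace (E : Set (PontryaginDual G)))
    (hP : ∀ f ∈ trigSpace (E : Set (PontryaginDual G)), P f = f) (f : C(G, ℂ)) :
    ‖∫ g, f g * conj (dirichletKernel E g) ∂m‖ ≤ ‖P‖ * ‖f‖ := by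
  have h1 : ∀ γ ∈ E, ∫ g, conj (charFun γ g) * fourierFunctional m γ (P (leftTranslate f g)) ∂m =
      ∫ g, f g * conj (charFun γ g) ∂m := by
    intro γ hγ
    have hint : Integrable (fun g => conj (charFun γ g) • leftTranslate f g) m :=
      Continuous.integrable_of_compactSpace' m (by fun_prop)
    have := ContinuousLinearMap.integral_comp_comm (fourierFunctional m γ ∘L P) hint
    simp only [map_smul, integral_conj_charFun_smul_leftTranslate, ContinuousLinearMap.comp_apply,
      hP _ (charFun_mem_trigSpace (E := (E : Set (PontryaginDual G))) hγ), smul_eq_mul,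
      fourierFunctional_charFun, if_true, mul_one] at this
    rw [this, fourierFunctional_apply]
  have h2 : ∀ g, P (leftTranslate f g) g⁻¹ =
      ∑ γ ∈ E, conj (charFun γ g) * fourierFunctional m γ (P (leftTranslate f g)) := by
    intro g
    conv_lhs => rw [← sum_fourierFunctional_smul m (hPmem (leftTranslate f g))]
    rw [ContinuousMap.sum_apply]
    refine Finset.sum_congr rfl fun γ _ => ?_
    have : charFun γ g⁻¹ = conj (charFun γ g) := by
      change ((γ g⁻¹ : Circle) : ℂ) = conj ((γ g : Circle) : ℂ)
      rw [map_inv, Circle.coe_inv_eq_conj]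
    rw [ContinuousMap.smul_apply, this, smul_eq_mul, mul_comm]
  have h3 : ∫ g, P (leftTranslate f g) g⁻¹ ∂m = ∫ g, f g * conj (dirichletKernel E g) ∂m := by
    simp_rw [h2, dirichletKernel_apply, map_sum, Finset.mul_sum]
    rw [integral_finsetSum _ fun γ _ => Continuous.integrable_of_compactSpace' m (by fun_prop),
      integral_finsetSum _ fun γ _ => Continuous.integrable_of_compactSpace' m (by fun_prop)]
    exact Finset.sum_congr rfl h1
  rw [← h3]
  refine (norm_integral_le_of_norm_le_const (C := ‖P‖ * ‖f‖) (.of_forall fun g => ?_)).trans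
    (by simp)
  calc ‖P (leftTranslate f g) g⁻¹‖ ≤ ‖P (leftTranslate f g)‖ := ContinuousMap.norm_coe_le_norm _ _
    _ ≤ ‖P‖ * ‖leftTranslate f g‖ := P.le_opNorm _
    _ ≤ ‖P‖ * ‖f‖ := by gcongr; exact norm_leftTranslate_le f g

theorem integral_norm_dirichletKernel_le {E : Finset (PontryaginDual G)}
    {P : C(G, ℂ) →L[ℂ] C(G, ℂ)}
    (hPmem : ∀ f, P f ∈ trigSpace (E : Set (PontryaginDual G)))
    (hP : ∀ f ∈ trigSpace (E : Set (PontryaginDual G)), P f = f) :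
    ∫ g, ‖dirichletKernel E g‖ ∂m ≤ ‖P‖ := by
  refine le_of_forall_pos_le_add fun ε hε => ?_
  set D := dirichletKernel E
  have hpos : ∀ g, 0 < ‖D g‖ + ε := fun g => by positivity
  -- A continuous substitute for the sign of `D`, which may be discontinuous at zeros of `D`.
  let f : C(G, ℂ) := ⟨fun g => D g / ((‖D g‖ + ε : ℝ) : ℂ), by
    refine D.continuous.div (by fun_prop) fun g => ?_
    exact_mod_cast (hpos g).ne'⟩
  have hf : ‖f‖ ≤ 1 := (ContinuousMap.norm_le _ zero_le_one).2 fun g => by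
    change ‖D g / ((‖D g‖ + ε : ℝ) : ℂ)‖ ≤ 1
    rw [norm_div, Complex.norm_real, Real.norm_of_nonneg (hpos g).le, div_le_one (hpos g)]
    linarith
  have key := norm_integral_mul_conj_dirichletKernel_le m hPmem hP f
  have e : ∀ g, f g * conj (D g) = ((‖D g‖ ^ 2 / (‖D g‖ + ε) : ℝ) : ℂ) := fun g => by
    change D g / ((‖D g‖ + ε : ℝ) : ℂ) * conj (D g) = _
    rw [div_mul_eq_mul_div, Complex.mul_conj, Complex.normSq_eq_norm_sq]
    push_cast; rfl
  have hcont : Continuous fun g => ‖D g‖ ^ 2 / (‖D g‖ + ε) :=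
    Continuous.div (by fun_prop) (by fun_prop) fun g => (hpos g).ne'
  simp only [D] at e
  simp_rw [e] at key
  rw [integral_complex_ofReal, Complex.norm_real] at key
  have hle : ∫ g, ‖D g‖ ∂m ≤ ∫ g, (‖D g‖ ^ 2 / (‖D g‖ + ε) + ε) ∂m := by
    refine integral_mono (Continuous.integrable_of_compactSpace' m (by fun_prop))
      (Continuous.integrable_of_compactSpace' m (by fun_prop)) fun g => ?_
    change ‖D g‖ ≤ ‖D g‖ ^ 2 / (‖D g‖ + ε) + ε
    -- Reduces to `(t - ε)(t + ε) ≤ t²` with `t = ‖D g‖`.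
    rw [← sub_le_iff_le_add, le_div_iff₀ (hpos g)]
    nlinarith [sq_nonneg ε]
  rw [integral_add (hcont.integrable_of_compactSpace' m) (integrable_const _)] at hle
  simp only [integral_const, probReal_univ, one_smul] at hle
  refine hle.trans ?_
  gcongr
  exact (le_abs_self _).trans (key.trans (mul_le_of_le_one_right (norm_nonneg _) hf))

theorem sqrt_card_le_mul_integral_norm_dirichletKernel {E : Finset (PontryaginDual G)} {C : ℝ}
    (hC : C ∈ lambdaBounds m 2 (E : Set (PontryaginDual G))) :
    √(E.card : ℝ) ≤ C * ∫ g, ‖dirichletKernel E g‖ ∂m := by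
  have h := hC.2 _ (dirichletKernel_mem E)
  have hcont := (dirichletKernel E).continuous
  have hL2 : MemLp (dirichletKernel E) 2 m :=
    hcont.memLp_of_hasCompactSupport (HasCompactSupport.of_compactSpace _)
  rw [eLpNorm_one_eq_lintegral_enorm,
    ← ofReal_integral_norm_eq_lintegral_enorm (hcont.integrable_of_compactSpace' m),
    ← ENNReal.ofReal_mul hC.1.le, hL2.eLpNorm_eq_integral_rpow_norm two_ne_zero
      ENNReal.ofNat_ne_top, ENNReal.ofReal_le_ofReal_iff
      (mul_nonneg hC.1.le (integral_nonneg fun _ => norm_nonneg _))] at h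
  simp only [ENNReal.toReal_ofNat, Real.rpow_two, integral_norm_dirichletKernel_sq] at h
  rwa [Real.sqrt_eq_rpow, one_div]

theorem ofReal_inv_mul_sqrt_card_le_projConst {E : Finset (PontryaginDual G)} {C : ℝ}
    (hC : C ∈ lambdaBounds m 2 (E : Set (PontryaginDual G))) :
    ENNReal.ofReal (C⁻¹ * √(E.card : ℝ)) ≤
      projConst (trigSpace (E : Set (PontryaginDual G))) := by
  set X := trigSpace (E : Set (PontryaginDual G))
  have hrange : LinearMap.range X.subtypeₗᵢ.toLinearMap = X := X.range_subtype
  have hcompl : (LinearMap.range X.subtypeₗᵢ.toLinearMap).ClosedComplemented :=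
    Submodule.ClosedComplemented.of_finiteDimensional _
  -- The single ambient space `C(G)` already yields the lower bound.
  have hle : relProjConst (LinearMap.range X.subtypeₗᵢ.toLinearMap) ≤ projConst X :=
    le_iSup_of_le C(G, ℂ) <| le_iSup_of_le inferInstance <| le_iSup_of_le inferInstance <|
      le_iSup_of_le inferInstance <| le_iSup_of_le X.subtypeₗᵢ <| le_iSup_of_le hcompl le_rfl
  refine le_trans (le_iInf₂ fun P hP => ?_) hle
  let Q : C(G, ℂ) →L[ℂ] C(G, ℂ) := (Submodule.subtypeL _) ∘L P
  have hQ : ‖Q‖ ≤ ‖P‖ := ContinuousLinearMap.opNorm_le_bound _ P.opNorm_nonneg P.le_opNorm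
  have hD : ∫ g, ‖dirichletKernel E g‖ ∂m ≤ ‖Q‖ := by
    refine integral_norm_dirichletKernel_le m (P := Q) (fun f => ?_) fun f hf => ?_
    · exact hrange.le (P f).2
    · exact congrArg Subtype.val (hP ⟨f, hrange.ge hf⟩)
  rw [← ofReal_norm]
  refine ENNReal.ofReal_le_ofReal ?_
  rw [inv_mul_le_iff₀ hC.1]
  refine (sqrt_card_le_mul_integral_norm_dirichletKernel m hC).trans ?_
  have := hC.1
  gcongr
  exact hD.trans hQ

end LowerBound

theorem corollary1p2 {G : Type u} [CommGroup G] [TopologicalSpace G] [IsTopologicalGroup G]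
    [CompactSpace G] [MeasurableSpace G] [BorelSpace G]
    (m : MeasureTheory.Measure G) [m.IsHaarMeasure] [MeasureTheory.IsProbabilityMeasure m]
    (E : Finset (PontryaginDual G)) (hE : E.Nonempty) :
    IsLeast (lambdaBounds m 2 (E : Set (PontryaginDual G)))
        (lambdaConst m 2 (E : Set (PontryaginDual G))) ∧
      ENNReal.ofReal ((lambdaConst m 2 (E : Set (PontryaginDual G)))⁻¹ * √(E.card : ℝ)) ≤
        projConst (trigSpace (E : Set (PontryaginDual G))) ∧
      projConst (trigSpace (E : Set (PontryaginDual G))) ≤ ENNReal.ofReal √(E.card : ℝ) :=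
  ⟨isLeast_lambdaConst m hE,
    ofReal_inv_mul_sqrt_card_le_projConst m (isLeast_lambdaConst m hE).1,
    projConst_trigSpace_le m E⟩
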